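/- **Setting.** Let $n,L,D\ge 1$ and $K\ge 0$ be integers. Sources $i=1,\dots,n$ share $L$ channels. In each slot the age vector is $\boldsymbol a\in\mathscr A=\{1,\dots,D\}^n$, and a scheduler chooses an allocation $\boldsymbol l\in\mathscr L=\{0,\dots,L\}^n$ ($l_i$ is the number of channels used by source $i$) that satisfies the collision constraint, i.e. $\boldsymbol l\in\mathscr L_1=\{\boldsymbol l\in\mathscr L:\ l_\Sigma=\sum_i l_i\le L\}$. Independently over the sources, the update of source $i$ succeeds with probability $1-(1-\mu_i)^{l_i}$, where $0\le\mu_i<1$; after a success the age of source $i$ becomes $1$, otherwise $\min(a_i+1,D)$. Write $P(\boldsymbol a'\mid\boldsymbol a,\boldsymbol l)$ for the resulting transition probabilities. Given energy budgets $b_i$, functions $\omega_0,\omega_1,\dots,\omega_K:\mathscr A\to\mathbb R$ and bounds $c_1,\dots,c_K$, and an arbitrary distribution of the initial age vector, the constrained age-optimization problem is $$\min_{\boldsymbol u}\ \lim_{T\to\infty}\frac1T\sum_{t=1}^T\mathbb E[\omega_0(\boldsymbol A[t])]\quad\text{s.t.}\quad \lim_{T\to\infty}\frac1T\sum_{t=1}^T\mathbb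 E[u_i[t]]\le b_i\ (1\le i\le n),\quad \lim_{T\to\infty}\frac1T\sum_{t=1}^T\mathbb E[\omega_k(\boldsymbol A[t])]\le c_k\ (1\le k\le K),$$ over all randomized scheduling policies with values in $\mathscr L_1$, which may depend on the whole history (with $\limsup$ in place of $\lim$ where the limit does not exist). A randomized stationary policy is one that, at age vector $\boldsymbol a$, chooses $\boldsymbol l$ with a fixed probability $f_{\boldsymbol a}^{\boldsymbol l}$, where $f_{\boldsymbol a}^{\boldsymbol l}=0$ for $\boldsymbol l\notin\mathscr L_1$. The associated linear program, in the variables $y_{\boldsymbol a}^{\boldsymbol l}$ ($\boldsymbol a\in\mathscr A$, $\boldsymbol l\in\mathscr L$), is $$\begin{aligned}\min\ &\sum_{\boldsymbol a\in\mathscr A}\sum_{\boldsymbol l\in\mathscr L_1}y_{\boldsymbol a}^{\boldsymbol l}\,\omega_0(\boldsymbol a)\\ \text{s.t.}\ &\sum_{\boldsymbol a\in\mathscr A}\sum_{\boldsymbol l\in\mathscr L_1}y_{\boldsymbol a}^{\boldsymbol l}\,l_i\le b_i\ (1\le i\le n),\qquad \sum_{\boldsymbol a\in\mathscr A}\sum_{\boldsymbol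 l\in\mathscr L_1}y_{\boldsymbol a}^{\boldsymbol l}\,\omega_k(\boldsymbol a)\le c_k\ (1\le k\le K),\\ &0\le y_{\boldsymbol a}^{\boldsymbol l}\le1,\qquad y_{\boldsymbol a}^{\boldsymbol l}=0\ \ (\boldsymbol l\in\mathscr L\setminus\mathscr L_1),\qquad \sum_{\boldsymbol a\in\mathscr A}\sum_{\boldsymbol l\in\mathscr L_1}y_{\boldsymbol a}^{\boldsymbol l}=1,\qquad \mathbf Q\boldsymbol y=\boldsymbol 0,\end{aligned}$$ where $\mathbf Q\boldsymbol y=\boldsymbol 0$ stands for the global balance equations $\sum_{\boldsymbol l}y_{\boldsymbol a'}^{\boldsymbol l}=\sum_{\boldsymbol a}\sum_{\boldsymbol l}y_{\boldsymbol a}^{\boldsymbol l}P(\boldsymbol a'\mid\boldsymbol a,\boldsymbol l)$ for all $\boldsymbol a'\in\mathscr A$. **Theorem (multi-user LP equivalence).** The age-optimization problem and the linear program are equivalent, as follows. 1. Under every randomized stationary policy $f$ the long-run average of every function of age vector and allocation exists; these averages are $\sum_{\boldsymbol a,\boldsymbol l}y_{\boldsymbol a}^{\boldsymbol l}g(\boldsymbol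 a,\boldsymbol l)$ for some $y$ that satisfies all constraints of the linear program other than the energy and age-cost ones, and $y_{\boldsymbol a}^{\boldsymbol l}=\big(\sum_{\boldsymbol l'}y_{\boldsymbol a}^{\boldsymbol l'}\big)f_{\boldsymbol a}^{\boldsymbol l}$. The policy is feasible if and only if $y$ is feasible, and they have the same cost. 2. Conversely, for every feasible point $y$ of the linear program, the randomized stationary policy $$f_{\boldsymbol a}^{\boldsymbol l}=\begin{cases}y_{\boldsymbol a}^{\boldsymbol l}\big/\sum_{\boldsymbol l'\in\mathscr L}y_{\boldsymbol a}^{\boldsymbol l'},&\text{if }\sum_{\boldsymbol l'\in\mathscr L}y_{\boldsymbol a}^{\boldsymbol l'}\ne0,\\ 1/|\mathscr L_1|,&\text{if }\sum_{\boldsymbol l'\in\mathscr L}y_{\boldsymbol a}^{\boldsymbol l'}=0\text{ and }\boldsymbol l\in\mathscr L_1,\\ 0,&\text{otherwise,}\end{cases}$$ is feasible, has the long-run averages $\sum_{\boldsymbol a,\boldsymbol l}y_{\boldsymbol a}^{\boldsymbol l}g(\boldsymbol a,\boldsymbol l)$, and has the cost of $y$. 3. The age-optimization problem is feasible if and only if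 the linear program is, and the two problems have the same minimum. 4. If the linear program is feasible, it has an optimal solution; and for every optimal solution $y$, the randomized stationary policy $f$ obtained from $y$ as in 2 is optimal for the age-optimization problem, with cost equal to the optimal value of the linear program. -/

import Mathlib

open Filter Topology

noncomputable section

namespace AgeLP

/-- The ages `1, …, D` of a single source (`D` is the cap on the age). -/
abbrev Age (D : ℕ) : Type := ↥(Finset.Icc 1 D)

/-- The product age space `{1, …, D}ⁿ`. -/
abbrev AgeVec (n D : ℕ) : Type := Fin n → Age D

/-- Allocation vectors `{0, …, L}ⁿ`: `l i` is the number of channels used by source `i`. -/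
abbrev Alloc (n L : ℕ) : Type := Fin n → Fin (L + 1)

/-- The allocations that respect the collision constraint `∑ i, l i ≤ L`. -/
def collisionFree (n L : ℕ) : Finset (Alloc n L) :=
  Finset.univ.filter fun l => ∑ i, (l i : ℕ) ≤ L

/-- The data of the constrained age-optimization problem with `n` sources, `L` channels, age cap `D`
and `K` age-cost constraints. -/
structure Problem (n L D K : ℕ) where
  /-- success probability of source `i` on each of its channels -/
  μ : Fin n → ℝ
  /-- energy budgets -/
  b : Fin n → ℝ
  /-- objective age cost -/
  ω₀ : AgeVec n D → ℝ
  /-- age costs of the constraints -/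
  ω : Fin K → AgeVec n D → ℝ
  /-- bounds of the age-cost constraints -/
  c : Fin K → ℝ

variable {n L D K : ℕ}

/-- One-step transition probability of the age vector from `a` to `a'` under the allocation `l`.
The sources are independent; source `i` succeeds with probability `1 - (1 - μ i) ^ l i`, and then its
age becomes `1`; otherwise its age grows by one, capped at `D`. -/
def step (μ : Fin n → ℝ) (a : AgeVec n D) (l : Alloc n L) (a' : AgeVec n D) : ℝ :=
  ∏ i, ((if (a' i : ℕ) = 1 then 1 - (1 - μ i) ^ (l i : ℕ) else 0) +
    (if (a' i : ℕ) = min ((a i : ℕ) + 1) D then (1 - μ i) ^ (l i : ℕ) else 0))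

/-- A (history-dependent, randomized) scheduling policy. `prob h a l` is the probability of the
allocation `l` when the current age vector is `a` and the list of past pairs
(age vector, allocation) is `h`, most recent pair first. -/
structure Policy (n L D : ℕ) where
  prob : List (AgeVec n D × Alloc n L) → AgeVec n D → Alloc n L → ℝ
  mem_simplex : ∀ h a, prob h a ∈ stdSimplex ℝ (Alloc n L)
  collision : ∀ h a l, l ∉ collisionFree n L → prob h a l = 0

/-- `f a l` is the probability of the allocation `l` at the age vector `a`: a randomized stationary
(Markovian) policy. -/
def IsStationaryRule (f : AgeVec n D → Alloc n L → ℝ) : Prop :=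
  (∀ a, f a ∈ stdSimplex ℝ (Alloc n L)) ∧ ∀ a l, l ∉ collisionFree n L → f a l = 0

/-- A randomized stationary policy as a policy. -/
def Policy.ofRule (f : AgeVec n D → Alloc n L → ℝ) (hf : IsStationaryRule f) : Policy n L D where
  prob := fun _ => f
  mem_simplex := fun _ => hf.1
  collision := fun _ => hf.2

/-- The probability that the past pairs (age vector, allocation) are `h` and the current age vector
is `a`, when the initial age vector has law `ν` and the policy `φ` is used. -/
def pathProb (μ : Fin n → ℝ) (ν : AgeVec n D → ℝ) (φ : Policy n L D) :
    List (AgeVec n D × Alloc n L) → AgeVec n D → ℝ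
  | [], a => ν a
  | p :: h, a => pathProb μ ν φ h p.1 * φ.prob h p.1 p.2 * step μ p.1 p.2 a

/-- The expectation `𝔼[g(A, u)]` of a function of the age vector and the allocation in the slot that is
preceded by `t` slots. -/
def expect (μ : Fin n → ℝ) (ν : AgeVec n D → ℝ) (φ : Policy n L D)
    (g : AgeVec n D → Alloc n L → ℝ) (t : ℕ) : ℝ :=
  ∑ h : Fin t → AgeVec n D × Alloc n L, ∑ a, ∑ l,
    pathProb μ ν φ (List.ofFn h) a * φ.prob (List.ofFn h) a l * g a l

/-- The expected average of `g(A, u)` over the first `T` slots. -/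
def timeAvg (μ : Fin n → ℝ) (ν : AgeVec n D → ℝ) (φ : Policy n L D)
    (g : AgeVec n D → Alloc n L → ℝ) (T : ℕ) : ℝ :=
  (1 / (T : ℝ)) * ∑ t ∈ Finset.range T, expect μ ν φ g t

/-- The long-run average of `g(A, u)`: the limit of the time averages, and the upper limit for a policy
under which they do not converge. -/
def longRun (μ : Fin n → ℝ) (ν : AgeVec n D → ℝ) (φ : Policy n L D)
    (g : AgeVec n D → Alloc n L → ℝ) : ℝ :=
  limsup (timeAvg μ ν φ g) atTop

namespace Problem

variable (M : Problem n L D K) (ν : AgeVec n D → ℝ)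

/-! The constrained Markov decision problem, for the initial law `ν`. -/

/-- The objective: the long-run average of `ω₀`. -/
def cost (φ : Policy n L D) : ℝ := longRun M.μ ν φ fun a _ => M.ω₀ a

/-- The policy satisfies the energy constraints and the age-cost constraints. -/
def Feasible (φ : Policy n L D) : Prop :=
  (∀ i, longRun M.μ ν φ (fun _ l => ((l i : ℕ) : ℝ)) ≤ M.b i) ∧
  ∀ k, longRun M.μ ν φ (fun a _ => M.ω k a) ≤ M.c k

/-- The policy is feasible and minimizes the objective among all feasible policies. -/
def IsOptimal (φ : Policy n L D) : Prop :=
  M.Feasible ν φ ∧ ∀ ψ : Policy n L D, M.Feasible ν ψ → M.cost ν φ ≤ M.cost ν ψ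

/-! The linear program, in the variables `y a l`. -/

/-- The matrix of the global balance equations: row `a'` of `Q y` is
`∑ l, y a' l - ∑ a, ∑ l, y a l * step μ a l a'`. -/
def balance : Matrix (AgeVec n D) (AgeVec n D × Alloc n L) ℝ :=
  fun a' p => (if p.1 = a' then 1 else 0) - step M.μ p.1 p.2 a'

/-- The constraints of the linear program other than those on energy and age costs. -/
structure IsOccupation (y : AgeVec n D → Alloc n L → ℝ) : Prop where
  bounds : ∀ a l, 0 ≤ y a l ∧ y a l ≤ 1
  collision : ∀ a l, l ∉ collisionFree n L → y a l = 0
  total : ∑ a, ∑ l ∈ collisionFree n L, y a l = 1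
  balanced : M.balance.mulVec (fun p => y p.1 p.2) = 0

/-- All constraints of the linear program. -/
structure LPFeasible (y : AgeVec n D → Alloc n L → ℝ) : Prop extends M.IsOccupation y where
  energy : ∀ i, ∑ a, ∑ l ∈ collisionFree n L, y a l * ((l i : ℕ) : ℝ) ≤ M.b i
  ageCost : ∀ k, ∑ a, ∑ l ∈ collisionFree n L, y a l * M.ω k a ≤ M.c k

/-- The objective of the linear program. -/
def lpCost (y : AgeVec n D → Alloc n L → ℝ) : ℝ :=
  ∑ a, ∑ l ∈ collisionFree n L, y a l * M.ω₀ a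

/-- `y` is an optimal solution of the linear program. -/
def IsLPOptimal (y : AgeVec n D → Alloc n L → ℝ) : Prop :=
  M.LPFeasible y ∧ ∀ z : AgeVec n D → Alloc n L → ℝ, M.LPFeasible z → M.lpCost y ≤ M.lpCost z

end Problem

/-- Normalization of `y` over the allocations: `f a l = y a l / ∑ l', y a l'`; at the age vectors `a`
where the sum is `0`, the uniform distribution over the collision-free allocations. -/
def ruleOf (y : AgeVec n D → Alloc n L → ℝ) (a : AgeVec n D) (l : Alloc n L) : ℝ :=
  if ∑ l', y a l' ≠ 0 then y a l / ∑ l', y a l'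
  else if l ∈ collisionFree n L then 1 / ((collisionFree n L).card : ℝ) else 0

end AgeLP

end

open AgeLP

/-! Let `avgOcc` be the law of (age vector, allocation) averaged over the first T slots. Time
averages are linear functionals of it (`timeAvg_eq`), and it stays in a compact box. Its defect in
the balance equations telescopes to (initial age law − age law after T slots)/T (`balance_avgOcc`),
so every cluster point satisfies the balance, collision and normalization constraints
(`isOccupation_of_tendsto`). A limit along an ultrafilter finer than `atTop` is at most the upper
limit (`le_longRun`), so a cluster point of a feasible policy is LP feasible at no larger cost.

Conversely, a stationary rule makes the ages a Markov chain with a unique invariant law: all updates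
fail together with positive probability because `μ i < 1`, and D such slots lead from anywhere to
(D, …, D) (`invariant_eq_zero`, `iterate_grow_eq`). Hence `avgOcc` has a single cluster point and
converges to it, whatever the initial law. An LP point `y` factors as its age marginal times `ruleOf
y`, so it is the limit under that rule. -/

noncomputable section

namespace AgeLP

variable {n L D K : ℕ}

/-! ### One-step transitions and the all-failures path -/

section Step

variable {μ : Fin n → ℝ} (hμ : ∀ i, 0 ≤ μ i ∧ μ i < 1)
include hμ

theorem step_nonneg (a : AgeVec n D) (l : Alloc n L) (a' : AgeVec n D) : 0 ≤ step μ a l a' := by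
  refine Finset.prod_nonneg fun i _ => ?_
  have h0 : 0 ≤ 1 - μ i := by linarith [(hμ i).2]
  have h1 : (1 - μ i) ^ (l i : ℕ) ≤ 1 := pow_le_one₀ h0 (by linarith [(hμ i).1])
  have h2 : 0 ≤ (1 - μ i) ^ (l i : ℕ) := pow_nonneg h0 _
  split_ifs <;> linarith

omit hμ in
theorem sum_step (hD : 1 ≤ D) (a : AgeVec n D) (l : Alloc n L) :
    ∑ a', step μ a l a' = 1 := by
  unfold step
  rw [← Fintype.prod_sum (fun i (x : Age D) =>
    (if (x : ℕ) = 1 then 1 - (1 - μ i) ^ (l i : ℕ) else 0) +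
    (if (x : ℕ) = min ((a i : ℕ) + 1) D then (1 - μ i) ^ (l i : ℕ) else 0))]
  refine Finset.prod_eq_one fun i _ => ?_
  have key : ∀ m (hm : m ∈ Finset.Icc 1 D) (r : ℝ),
      ∑ x : Age D, (if (x : ℕ) = m then r else 0) = r := by
    intro m hm r
    rw [Finset.sum_eq_single (⟨m, hm⟩ : Age D)]
    · simp
    · intro x _ hx
      rw [if_neg]
      exact fun h => hx (Subtype.ext h)
    · simp
  -- The two point masses are summed separately, so D = 1, where success and failure give the same
  -- age, needs no extra case.
  rw [Finset.sum_add_distrib, key 1 (by simp [hD]), key _ (by simp [Finset.mem_Icc]; omega)]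
  ring

/-- The age vector after a slot in which every update fails. -/
def grow (hD : 1 ≤ D) (a : AgeVec n D) : AgeVec n D := fun i =>
  ⟨min ((a i : ℕ) + 1) D, by simp [Finset.mem_Icc]; omega⟩

theorem step_grow_pos (hD : 1 ≤ D) (a : AgeVec n D) (l : Alloc n L) :
    0 < step μ a l (grow hD a) := by
  refine Finset.prod_pos fun i _ => ?_
  have h0 : 0 < 1 - μ i := by linarith [(hμ i).2]
  have h1 : (1 - μ i) ^ (l i : ℕ) ≤ 1 := pow_le_one₀ h0.le (by linarith [(hμ i).1])
  have h2 : 0 < (1 - μ i) ^ (l i : ℕ) := pow_pos h0 _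
  rw [if_pos (show ((grow hD a i : Age D) : ℕ) = min ((a i : ℕ) + 1) D from rfl)]
  split_ifs <;> linarith

omit hμ in
theorem coe_iterate_grow (hD : 1 ≤ D) (k : ℕ) (a : AgeVec n D) (i : Fin n) :
    ((((grow hD)^[k] a) i : Age D) : ℕ) = min ((a i : ℕ) + k) D := by
  induction k with
  | zero =>
    have := Finset.mem_Icc.1 (a i).2
    simp [this.2]
  | succ k ih =>
    rw [Function.iterate_succ_apply']
    change min ((((grow hD)^[k] a) i : ℕ) + 1) D = _
    rw [ih]
    omega

omit hμ in
theorem iterate_grow_eq (hD : 1 ≤ D) (a a' : AgeVec n D) :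
    (grow hD)^[D] a = (grow hD)^[D] a' := by
  funext i
  apply Subtype.ext
  rw [coe_iterate_grow, coe_iterate_grow]
  omega

end Step

/-! ### Uniqueness of invariant vectors of a stochastic matrix -/

section Uniqueness

variable {α : Type*} [Fintype α]

/-- The positive part of an invariant vector of a stochastic matrix is invariant. -/
theorem posPart_invariant {P : α → α → ℝ} (hP : ∀ a a', 0 ≤ P a a') (hP1 : ∀ a, ∑ a', P a a' = 1)
    {d : α → ℝ} (hd : ∀ a', d a' = ∑ a, d a * P a a') (a' : α) :
    max (d a') 0 = ∑ a, max (d a) 0 * P a a' := by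
  have hle : ∀ a' ∈ Finset.univ, max (d a') 0 ≤ ∑ a, max (d a) 0 * P a a' := by
    intro a' _
    refine max_le ?_ (Finset.sum_nonneg fun a _ => mul_nonneg (le_max_right _ _) (hP _ _))
    rw [hd a']
    exact Finset.sum_le_sum fun a _ => mul_le_mul_of_nonneg_right (le_max_left _ _) (hP _ _)
  have hsum : ∑ a', max (d a') 0 = ∑ a', ∑ a, max (d a) 0 * P a a' := by
    rw [Finset.sum_comm]
    simp_rw [← Finset.mul_sum, hP1, mul_one]
  -- Termwise inequality with equal total mass forces termwise equality.
  exact (Finset.sum_eq_sum_iff_of_le hle).1 hsum a' (Finset.mem_univ _)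

/-- If some state is reached from every state along the positive transitions `a → g a`, an invariant
vector of total mass zero vanishes. -/
theorem invariant_eq_zero {P : α → α → ℝ} (hP : ∀ a a', 0 ≤ P a a')
    (hP1 : ∀ a, ∑ a', P a a' = 1) {g : α → α} (hg : ∀ a, 0 < P a (g a)) {k : ℕ}
    (hk : ∀ a a', g^[k] a = g^[k] a') {d : α → ℝ} (hd : ∀ a', d a' = ∑ a, d a * P a a')
    (hd0 : ∑ a, d a = 0) : d = 0 := by
  have reach : ∀ e : α → ℝ, (∀ a', e a' = ∑ a, e a * P a a') → ∀ a, 0 < e a →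
      ∀ j, 0 < e (g^[j] a) := by
    intro e he a ha j
    induction j with
    | zero => exact ha
    | succ j ih =>
      have hpos := posPart_invariant hP hP1 he (g (g^[j] a))
      rw [Function.iterate_succ_apply']
      have h1 : 0 < max (e (g^[j] a)) 0 * P (g^[j] a) (g (g^[j] a)) :=
        mul_pos (lt_max_of_lt_left ih) (hg _)
      have h2 := Finset.single_le_sum (f := fun x => max (e x) 0 * P x (g (g^[j] a)))
        (fun _ _ => mul_nonneg (le_max_right _ _) (hP _ _)) (Finset.mem_univ (g^[j] a))
      have h3 : 0 < max (e (g (g^[j] a))) 0 := by rw [hpos]; exact h1.trans_le h2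
      exact (lt_max_iff.1 h3).resolve_right (lt_irrefl _)
  have hneg : ∀ a', (-d) a' = ∑ a, (-d) a * P a a' := by
    intro a'
    simp only [Pi.neg_apply, neg_mul, Finset.sum_neg_distrib]
    rw [hd a']
  by_contra hne
  -- A nonzero `d` of total zero has a positive and a negative entry; k steps along `g` carry both
  -- signs to the same state.
  obtain ⟨x, hx⟩ := Function.ne_iff.1 hne
  obtain ⟨a, -, ha⟩ := Finset.exists_pos_of_sum_zero_of_exists_nonzero d hd0
    ⟨x, Finset.mem_univ _, hx⟩
  obtain ⟨b, -, hb⟩ := Finset.exists_pos_of_sum_zero_of_exists_nonzero (-d) (by simp [hd0])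
    ⟨x, Finset.mem_univ _, neg_ne_zero.2 hx⟩
  have h1 := reach d hd a ha k
  have h2 := reach (-d) hneg b hb k
  rw [hk b a, Pi.neg_apply] at h2
  linarith

end Uniqueness
-- Averaged state-allocation laws
/-- The law of (age vector, allocation) in the slot that is preceded by `t` slots. -/
def occ (μ : Fin n → ℝ) (ν : AgeVec n D → ℝ) (φ : Policy n L D) (t : ℕ)
    (a : AgeVec n D) (l : Alloc n L) : ℝ :=
  ∑ h : Fin t → AgeVec n D × Alloc n L, pathProb μ ν φ (List.ofFn h) a * φ.prob (List.ofFn h) a l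

/-- The average of the laws of (age vector, allocation) in the first `T` slots. -/
def avgOcc (μ : Fin n → ℝ) (ν : AgeVec n D → ℝ) (φ : Policy n L D) (T : ℕ)
    (a : AgeVec n D) (l : Alloc n L) : ℝ :=
  (1 / (T : ℝ)) * ∑ t ∈ Finset.range T, occ μ ν φ t a l

section Occupation

variable (μ : Fin n → ℝ) (ν : AgeVec n D → ℝ) (φ : Policy n L D)

theorem expect_eq (g : AgeVec n D → Alloc n L → ℝ) (t : ℕ) :
    expect μ ν φ g t = ∑ a, ∑ l, occ μ ν φ t a l * g a l := by
  simp only [expect, occ, Finset.sum_mul]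
  rw [Finset.sum_comm]
  exact Finset.sum_congr rfl fun a _ => Finset.sum_comm

theorem timeAvg_eq (g : AgeVec n D → Alloc n L → ℝ) (T : ℕ) :
    timeAvg μ ν φ g T = ∑ a, ∑ l, avgOcc μ ν φ T a l * g a l := by
  simp only [timeAvg, avgOcc, expect_eq, mul_assoc, Finset.sum_mul, ← Finset.mul_sum]
  congr 1
  rw [Finset.sum_comm]
  exact Finset.sum_congr rfl fun a _ => Finset.sum_comm

theorem sum_occ_eq (t : ℕ) (a : AgeVec n D) :
    ∑ l, occ μ ν φ t a l =
      ∑ h : Fin t → AgeVec n D × Alloc n L, pathProb μ ν φ (List.ofFn h) a := by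
  simp only [occ]
  rw [Finset.sum_comm]
  exact Finset.sum_congr rfl fun h _ => by rw [← Finset.mul_sum, (φ.mem_simplex _ a).2, mul_one]

theorem sum_occ_zero (a : AgeVec n D) : ∑ l, occ μ ν φ 0 a l = ν a := by
  simp [sum_occ_eq, pathProb]

theorem sum_occ_succ (t : ℕ) (a' : AgeVec n D) :
    ∑ l, occ μ ν φ (t + 1) a' l = ∑ a, ∑ l, occ μ ν φ t a l * step μ a l a' := by
  -- A history of length t + 1 is its most recent pair prepended to a history of length t, matching
  -- the recursion of `pathProb`.
  have hcons : ∀ p : (AgeVec n D × Alloc n L) × (Fin t → AgeVec n D × Alloc n L),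
      List.ofFn (Fin.consEquiv (fun _ : Fin (t + 1) => AgeVec n D × Alloc n L) p) =
        p.1 :: List.ofFn p.2 := fun p => List.ofFn_cons p.1 p.2
  rw [sum_occ_eq, ← (Fin.consEquiv fun _ : Fin (t + 1) => AgeVec n D × Alloc n L).sum_comp]
  simp only [hcons, pathProb, occ, Finset.sum_mul, Fintype.sum_prod_type]

theorem occ_eq_zero (t : ℕ) (a : AgeVec n D) {l : Alloc n L} (hl : l ∉ collisionFree n L) :
    occ μ ν φ t a l = 0 := by
  simp [occ, φ.collision _ a l hl]

theorem avgOcc_eq_zero (T : ℕ) (a : AgeVec n D) {l : Alloc n L} (hl : l ∉ collisionFree n L) :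
    avgOcc μ ν φ T a l = 0 := by
  simp [avgOcc, occ_eq_zero μ ν φ _ a hl]

/-- The conditional law of the allocation ignores the history, so it factors out of the sum over
histories. -/
theorem occ_ofRule {f : AgeVec n D → Alloc n L → ℝ} (hf : IsStationaryRule f) (t : ℕ)
    (a : AgeVec n D) (l : Alloc n L) :
    occ μ ν (Policy.ofRule f hf) t a l = (∑ l', occ μ ν (Policy.ofRule f hf) t a l') * f a l := by
  rw [sum_occ_eq, Finset.sum_mul]
  rfl

theorem avgOcc_ofRule {f : AgeVec n D → Alloc n L → ℝ} (hf : IsStationaryRule f) (T : ℕ)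
    (a : AgeVec n D) (l : Alloc n L) :
    avgOcc μ ν (Policy.ofRule f hf) T a l =
      (∑ l', avgOcc μ ν (Policy.ofRule f hf) T a l') * f a l := by
  simp only [avgOcc, ← Finset.mul_sum, mul_assoc]
  congr 1
  rw [Finset.sum_comm, Finset.sum_mul]
  exact Finset.sum_congr rfl fun t _ => occ_ofRule μ ν hf t a l

variable {μ ν}
variable (hD : 1 ≤ D) (hμ : ∀ i, 0 ≤ μ i ∧ μ i < 1) (hν : ν ∈ stdSimplex ℝ (AgeVec n D))

include hμ hν in
theorem pathProb_nonneg (h : List (AgeVec n D × Alloc n L)) (a : AgeVec n D) :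
    0 ≤ pathProb μ ν φ h a := by
  induction h generalizing a with
  | nil => exact hν.1 a
  | cons p h ih =>
    exact mul_nonneg (mul_nonneg (ih _) ((φ.mem_simplex _ _).1 _)) (step_nonneg hμ _ _ _)

include hμ hν in
theorem occ_nonneg (t : ℕ) (a : AgeVec n D) (l : Alloc n L) : 0 ≤ occ μ ν φ t a l :=
  Finset.sum_nonneg fun _ _ =>
    mul_nonneg (pathProb_nonneg φ hμ hν _ _) ((φ.mem_simplex _ _).1 _)

include hμ hν in
theorem avgOcc_nonneg (T : ℕ) (a : AgeVec n D) (l : Alloc n L) : 0 ≤ avgOcc μ ν φ T a l :=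
  mul_nonneg (by positivity) (Finset.sum_nonneg fun _ _ => occ_nonneg φ hμ hν _ _ _)

include hD hν in
theorem sum_sum_occ (t : ℕ) : ∑ a, ∑ l, occ μ ν φ t a l = 1 := by
  induction t with
  | zero => simp only [sum_occ_zero, hν.2]
  | succ t ih =>
    simp only [sum_occ_succ]
    rw [Finset.sum_comm, ← ih]
    refine Finset.sum_congr rfl fun a _ => ?_
    rw [Finset.sum_comm]
    exact Finset.sum_congr rfl fun l _ => by rw [← Finset.mul_sum, sum_step hD, mul_one]

include hD hν in
theorem sum_sum_avgOcc {T : ℕ} (hT : T ≠ 0) : ∑ a, ∑ l, avgOcc μ ν φ T a l = 1 := by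
  have h := timeAvg_eq μ ν φ (fun _ _ => 1) T
  simp only [mul_one] at h
  rw [← h]
  simp [timeAvg, expect_eq, sum_sum_occ φ hD hν, hT]

include hD hμ hν in
theorem avgOcc_mem_Icc (T : ℕ) : avgOcc μ ν φ T ∈ Set.Icc 0 1 := by
  refine ⟨fun a l => avgOcc_nonneg φ hμ hν T a l, fun a l => ?_⟩
  -- For T = 0 the average is the zero function, still in the box although not a probability.
  rcases eq_or_ne T 0 with rfl | hT
  · simp [avgOcc]
  · rw [Pi.one_apply, Pi.one_apply, ← sum_sum_avgOcc (μ := μ) φ hD hν hT]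
    exact (Finset.single_le_sum (f := fun l => avgOcc μ ν φ T a l)
      (fun l _ => avgOcc_nonneg φ hμ hν T a l) (Finset.mem_univ l)).trans
      (Finset.single_le_sum (f := fun a => ∑ l, avgOcc μ ν φ T a l)
        (fun a _ => Finset.sum_nonneg fun l _ => avgOcc_nonneg φ hμ hν T a l) (Finset.mem_univ a))

/-- By `sum_occ_succ`, transporting the law of slot t gives the age marginal of slot t + 1, so the
sum over t telescopes. -/
theorem balance_avgOcc (T : ℕ) (a' : AgeVec n D) :
    ∑ l, avgOcc μ ν φ T a' l - ∑ a, ∑ l, avgOcc μ ν φ T a l * step μ a l a' =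
      (1 / (T : ℝ)) * (ν a' - ∑ l, occ μ ν φ T a' l) := by
  rw [← timeAvg_eq μ ν φ (fun a l => step μ a l a') T]
  simp only [avgOcc, timeAvg, ← Finset.mul_sum, expect_eq, ← sum_occ_succ]
  rw [Finset.sum_comm, ← mul_sub, ← Finset.sum_sub_distrib,
    Finset.sum_range_sub' (fun t => ∑ l, occ μ ν φ t a' l), sum_occ_zero]

include hD hμ hν in
theorem tendsto_balance_avgOcc (a' : AgeVec n D) :
    Tendsto (fun T => ∑ l, avgOcc μ ν φ T a' l - ∑ a, ∑ l, avgOcc μ ν φ T a l * step μ a l a')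
      atTop (𝓝 0) := by
  have hocc : ∀ T, 0 ≤ ∑ l, occ μ ν φ T a' l ∧ ∑ l, occ μ ν φ T a' l ≤ 1 := fun T =>
    ⟨Finset.sum_nonneg fun l _ => occ_nonneg φ hμ hν T a' l, by
      rw [← sum_sum_occ (μ := μ) φ hD hν T]
      exact Finset.single_le_sum (f := fun a => ∑ l, occ μ ν φ T a l)
        (fun a _ => Finset.sum_nonneg fun l _ => occ_nonneg φ hμ hν T a l) (Finset.mem_univ a')⟩
  have hν1 : ν a' ≤ 1 := by
    rw [← hν.2]
    exact Finset.single_le_sum (fun a _ => hν.1 a) (Finset.mem_univ a')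
  have hν0 := hν.1 a'
  simp only [balance_avgOcc]
  refine squeeze_zero_norm (fun T => ?_) tendsto_one_div_atTop_nhds_zero_nat
  rw [norm_mul, Real.norm_of_nonneg (by positivity : (0 : ℝ) ≤ 1 / T)]
  refine mul_le_of_le_one_right (by positivity) ?_
  rw [Real.norm_eq_abs, abs_le]
  constructor <;> linarith [(hocc T).1, (hocc T).2]

end Occupation

/-! ### Cluster points and convergence -/

section Limits

theorem mulVec_balance (M : Problem n L D K) (y : AgeVec n D → Alloc n L → ℝ) (a' : AgeVec n D) :
    M.balance.mulVec (fun p => y p.1 p.2) a' =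
      ∑ l, y a' l - ∑ a, ∑ l, y a l * step M.μ a l a' := by
  simp only [Matrix.mulVec, dotProduct, Problem.balance, sub_mul, Finset.sum_sub_distrib,
    Fintype.sum_prod_type]
  congr 1
  · simp
  · simp only [mul_comm]

theorem sum_collisionFree {y : Alloc n L → ℝ} (hy : ∀ l, l ∉ collisionFree n L → y l = 0)
    (g : Alloc n L → ℝ) : ∑ l ∈ collisionFree n L, y l * g l = ∑ l, y l * g l :=
  Finset.sum_subset (Finset.subset_univ _) fun l _ hl => by rw [hy l hl, zero_mul]

variable {M : Problem n L D K} {ν : AgeVec n D → ℝ} {φ : Policy n L D}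
  {y : AgeVec n D → Alloc n L → ℝ} {F : Filter ℕ} [F.NeBot]

theorem Problem.IsOccupation.sum_sum_mul (hy : M.IsOccupation y) (g : AgeVec n D → Alloc n L → ℝ) :
    ∑ a, ∑ l ∈ collisionFree n L, y a l * g a l = ∑ a, ∑ l, y a l * g a l :=
  Finset.sum_congr rfl fun a _ => sum_collisionFree (hy.collision a) (g a)

theorem Problem.IsOccupation.sum_sum (hy : M.IsOccupation y) : ∑ a, ∑ l, y a l = 1 := by
  have := hy.sum_sum_mul fun _ _ => 1
  simp only [mul_one] at this
  rw [← this, hy.total]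

theorem Problem.IsOccupation.sum_eq (hy : M.IsOccupation y) (a' : AgeVec n D) :
    ∑ l, y a' l = ∑ a, ∑ l, y a l * step M.μ a l a' := by
  have := congrFun hy.balanced a'
  rw [mulVec_balance, Pi.zero_apply] at this
  linarith

omit [F.NeBot] in
theorem tendsto_timeAvg (hy : Tendsto (avgOcc M.μ ν φ) F (𝓝 y))
    (g : AgeVec n D → Alloc n L → ℝ) :
    Tendsto (timeAvg M.μ ν φ g) F (𝓝 (∑ a, ∑ l, y a l * g a l)) := by
  rw [show timeAvg M.μ ν φ g = fun T => ∑ a, ∑ l, avgOcc M.μ ν φ T a l * g a l from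
    funext (timeAvg_eq M.μ ν φ g)]
  exact tendsto_finsetSum _ fun a _ => tendsto_finsetSum _ fun l _ =>
    ((tendsto_pi_nhds.1 (tendsto_pi_nhds.1 hy a) l).mul_const _)

/-- The limits of the averaged state-allocation laws of any policy satisfy the constraints of the
linear program other than those on energy and age costs. -/
theorem isOccupation_of_tendsto (hD : 1 ≤ D) (hμ : ∀ i, 0 ≤ M.μ i ∧ M.μ i < 1)
    (hν : ν ∈ stdSimplex ℝ (AgeVec n D)) (hF : F ≤ atTop)
    (hy : Tendsto (avgOcc M.μ ν φ) F (𝓝 y)) : M.IsOccupation y := by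
  have hcoord : ∀ a l, Tendsto (fun T => avgOcc M.μ ν φ T a l) F (𝓝 (y a l)) := fun a l =>
    tendsto_pi_nhds.1 (tendsto_pi_nhds.1 hy a) l
  have hIcc : y ∈ Set.Icc 0 1 :=
    isClosed_Icc.mem_of_tendsto hy (Eventually.of_forall (avgOcc_mem_Icc φ hD hμ hν))
  have hcol : ∀ a l, l ∉ collisionFree n L → y a l = 0 := fun a l hl =>
    tendsto_nhds_unique (hcoord a l) (by simp [avgOcc_eq_zero M.μ ν φ _ a hl])
  refine ⟨fun a l => ⟨hIcc.1 a l, hIcc.2 a l⟩, hcol, ?_, ?_⟩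
  · have h1 : ∑ a, ∑ l, y a l = 1 := by
      refine tendsto_nhds_unique (tendsto_finsetSum _ fun a _ => tendsto_finsetSum _ fun l _ =>
        hcoord a l) (Tendsto.congr' ?_ tendsto_const_nhds)
      filter_upwards [hF (eventually_ne_atTop 0)] with T hT
      exact (sum_sum_avgOcc φ hD hν hT).symm
    rw [← h1]
    exact Finset.sum_congr rfl fun a _ => by
      simpa using sum_collisionFree (hcol a) fun _ => 1
  · funext a'
    rw [mulVec_balance, Pi.zero_apply]
    exact tendsto_nhds_unique ((tendsto_finsetSum _ fun l _ => hcoord a' l).sub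
      (tendsto_finsetSum _ fun a _ => tendsto_finsetSum _ fun l _ => (hcoord a l).mul_const _))
      ((tendsto_balance_avgOcc φ hD hμ hν a').mono_left hF)

/-- A single ultrafilter makes the whole averaged law converge, so objective and constraints are
handled together. -/
theorem exists_ultrafilter_tendsto_avgOcc (hD : 1 ≤ D) (hμ : ∀ i, 0 ≤ M.μ i ∧ M.μ i < 1)
    (hν : ν ∈ stdSimplex ℝ (AgeVec n D)) (φ : Policy n L D) :
    ∃ (U : Ultrafilter ℕ) (y : AgeVec n D → Alloc n L → ℝ), (U : Filter ℕ) ≤ atTop ∧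
      Tendsto (avgOcc M.μ ν φ) U (𝓝 y) := by
  obtain ⟨y, -, hy⟩ := (isCompact_Icc (a := (0 : AgeVec n D → Alloc n L → ℝ))
    (b := 1)).exists_mapClusterPt_of_frequently (l := atTop) (f := avgOcc M.μ ν φ) (Frequently.of_forall (avgOcc_mem_Icc φ hD hμ hν))
  obtain ⟨U, hU, h⟩ := mapClusterPt_iff_ultrafilter.1 hy
  exact ⟨U, y, hU, h⟩

/-- For a given stationary rule there is at most one stationary state-allocation law. -/
theorem occupation_unique (hD : 1 ≤ D) (hμ : ∀ i, 0 ≤ M.μ i ∧ M.μ i < 1)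
    {f : AgeVec n D → Alloc n L → ℝ} (hf : IsStationaryRule f)
    {z : AgeVec n D → Alloc n L → ℝ} (hy : M.IsOccupation y) (hz : M.IsOccupation z)
    (hyf : ∀ a l, y a l = (∑ l', y a l') * f a l) (hzf : ∀ a l, z a l = (∑ l', z a l') * f a l) :
    y = z := by
  have inv : ∀ x, M.IsOccupation x → (∀ a l, x a l = (∑ l', x a l') * f a l) → ∀ a',
      ∑ l, x a' l = ∑ a, (∑ l, x a l) * ∑ l, f a l * step M.μ a l a' := by
    intro x hx hxf a'
    rw [hx.sum_eq]
    refine Finset.sum_congr rfl fun a _ => ?_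
    rw [Finset.mul_sum]
    refine Finset.sum_congr rfl fun l _ => ?_
    rw [hxf a l, mul_assoc]
  -- The difference of the two age marginals is invariant under the chain driven by `f` and has
  -- total mass zero.
  have h0 := invariant_eq_zero (P := fun a a' => ∑ l, f a l * step M.μ a l a')
    (g := grow hD) (k := D) (d := fun a => ∑ l, y a l - ∑ l, z a l)
    (fun a a' => Finset.sum_nonneg fun l _ => mul_nonneg ((hf.1 a).1 l) (step_nonneg hμ _ _ _))
    (fun a => by
      rw [Finset.sum_comm]
      simp_rw [← Finset.mul_sum, sum_step hD, mul_one]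
      exact (hf.1 a).2)
    (fun a => by
      obtain ⟨l, hl, hpos⟩ := Finset.exists_lt_of_sum_lt (s := Finset.univ) (f := fun _ => (0 : ℝ))
        (g := f a) (by rw [(hf.1 a).2]; simp)
      exact Finset.sum_pos' (fun l _ => mul_nonneg ((hf.1 a).1 l) (step_nonneg hμ _ _ _))
        ⟨l, hl, mul_pos hpos (step_grow_pos hμ hD a l)⟩)
    (iterate_grow_eq hD)
    (fun a' => by
      simp only [sub_mul, Finset.sum_sub_distrib]
      rw [inv y hy hyf a', inv z hz hzf a'])
    (by rw [Finset.sum_sub_distrib, hy.sum_sum, hz.sum_sum, sub_self])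
  funext a l
  rw [hyf a l, hzf a l, sub_eq_zero.1 (congrFun h0 a)]

/-- The factorization holds for each T by `avgOcc_ofRule` and passes to the limit. -/
theorem eq_mul_of_tendsto {f : AgeVec n D → Alloc n L → ℝ} {hf : IsStationaryRule f}
    (hy : Tendsto (avgOcc M.μ ν (Policy.ofRule f hf)) F (𝓝 y)) (a : AgeVec n D) (l : Alloc n L) :
    y a l = (∑ l', y a l') * f a l := by
  have hcoord : ∀ a l, Tendsto (fun T => avgOcc M.μ ν (Policy.ofRule f hf) T a l) F (𝓝 (y a l)) :=
    fun a l => tendsto_pi_nhds.1 (tendsto_pi_nhds.1 hy a) l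
  refine tendsto_nhds_unique (hcoord a l) ?_
  simp_rw [avgOcc_ofRule M.μ ν hf _ a l]
  exact (tendsto_finsetSum _ fun l' _ => hcoord a l').mul_const _

/-- The averaged laws under a stationary rule converge to its stationary state-allocation law. -/
theorem tendsto_avgOcc_ofRule (hD : 1 ≤ D) (hμ : ∀ i, 0 ≤ M.μ i ∧ M.μ i < 1)
    (hν : ν ∈ stdSimplex ℝ (AgeVec n D)) {f : AgeVec n D → Alloc n L → ℝ} (hf : IsStationaryRule f)
    (hy : M.IsOccupation y) (hyf : ∀ a l, y a l = (∑ l', y a l') * f a l) :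
    Tendsto (avgOcc M.μ ν (Policy.ofRule f hf)) atTop (𝓝 y) := by
  -- In a compact set, uniqueness of the cluster point is convergence.
  refine isCompact_Icc.tendsto_nhds_of_unique_mapClusterPt
    (Eventually.of_forall (avgOcc_mem_Icc _ hD hμ hν)) fun x _ hx => ?_
  obtain ⟨U, hU, h⟩ := mapClusterPt_iff_ultrafilter.1 hx
  exact occupation_unique hD hμ hf (isOccupation_of_tendsto hD hμ hν hU h) hy
    (eq_mul_of_tendsto h) hyf

theorem le_longRun (hD : 1 ≤ D) (hμ : ∀ i, 0 ≤ M.μ i ∧ M.μ i < 1)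
    (hν : ν ∈ stdSimplex ℝ (AgeVec n D)) (hF : F ≤ atTop)
    (hy : Tendsto (avgOcc M.μ ν φ) F (𝓝 y)) (g : AgeVec n D → Alloc n L → ℝ) :
    ∑ a, ∑ l, y a l * g a l ≤ longRun M.μ ν φ g := by
  -- Boundedness above is what makes the real `limsup` an eventual upper bound up to ε.
  have hbdd : IsBoundedUnder (· ≤ ·) atTop (timeAvg M.μ ν φ g) := by
    refine isBoundedUnder_of ⟨∑ a, ∑ l, |g a l|, fun T => ?_⟩
    rw [timeAvg_eq]
    refine Finset.sum_le_sum fun a _ => Finset.sum_le_sum fun l _ => ?_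
    have h := avgOcc_mem_Icc (μ := M.μ) φ hD hμ hν T
    exact (mul_le_mul_of_nonneg_left (le_abs_self _) (h.1 a l)).trans
      (mul_le_of_le_one_left (abs_nonneg _) (h.2 a l))
  refine le_of_forall_pos_le_add fun ε hε => ?_
  have hev : ∀ᶠ T in atTop, timeAvg M.μ ν φ g T < longRun M.μ ν φ g + ε :=
    eventually_lt_of_limsup_lt (lt_add_of_pos_right _ hε) hbdd
  exact le_of_tendsto (tendsto_timeAvg hy g) ((hev.filter_mono hF).mono fun _ h => h.le)

end Limits

/-! ### Policies against LP points; existence of an LP optimum -/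

namespace Problem

variable {M : Problem n L D K} {ν : AgeVec n D → ℝ} {φ : Policy n L D}
  {y : AgeVec n D → Alloc n L → ℝ}

theorem lpFeasible_iff (hy : M.IsOccupation y) : M.LPFeasible y ↔
    (∀ i, ∑ a, ∑ l, y a l * ((l i : ℕ) : ℝ) ≤ M.b i) ∧ ∀ k, ∑ a, ∑ l, y a l * M.ω k a ≤ M.c k := by
  simp only [← hy.sum_sum_mul fun _ l => ((l _ : ℕ) : ℝ), ← hy.sum_sum_mul fun a _ => M.ω _ a]
  exact ⟨fun h => ⟨h.energy, h.ageCost⟩, fun h => ⟨hy, h.1, h.2⟩⟩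

theorem lpCost_eq (hy : M.IsOccupation y) : M.lpCost y = ∑ a, ∑ l, y a l * M.ω₀ a :=
  hy.sum_sum_mul fun a _ => M.ω₀ a

theorem longRun_eq (hy : Tendsto (avgOcc M.μ ν φ) atTop (𝓝 y)) (g : AgeVec n D → Alloc n L → ℝ) :
    longRun M.μ ν φ g = ∑ a, ∑ l, y a l * g a l :=
  (tendsto_timeAvg hy g).limsup_eq

theorem feasible_iff_of_tendsto (hy : Tendsto (avgOcc M.μ ν φ) atTop (𝓝 y))
    (hocc : M.IsOccupation y) : M.Feasible ν φ ↔ M.LPFeasible y := by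
  simp only [lpFeasible_iff hocc, Feasible, longRun_eq hy]

theorem cost_eq_of_tendsto (hy : Tendsto (avgOcc M.μ ν φ) atTop (𝓝 y))
    (hocc : M.IsOccupation y) : M.cost ν φ = M.lpCost y := by
  rw [lpCost_eq hocc, cost, longRun_eq hy]

/-- Every feasible policy is at least as costly as some feasible point of the linear program. -/
theorem Feasible.exists_lpFeasible (hD : 1 ≤ D) (hμ : ∀ i, 0 ≤ M.μ i ∧ M.μ i < 1)
    (hν : ν ∈ stdSimplex ℝ (AgeVec n D)) (h : M.Feasible ν φ) :
    ∃ y, M.LPFeasible y ∧ M.lpCost y ≤ M.cost ν φ := by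
  obtain ⟨U, y, hU, hy⟩ := exists_ultrafilter_tendsto_avgOcc hD hμ hν φ
  have hocc := isOccupation_of_tendsto hD hμ hν hU hy
  have hle := le_longRun hD hμ hν hU hy
  exact ⟨y, (lpFeasible_iff hocc).2 ⟨fun i => (hle _).trans (h.1 i), fun k => (hle _).trans (h.2 k)⟩,
    (lpCost_eq hocc).trans_le (hle _)⟩

theorem isCompact_lpFeasible (M : Problem n L D K) : IsCompact {y | M.LPFeasible y} := by
  refine (isCompact_Icc (a := (0 : AgeVec n D → Alloc n L → ℝ)) (b := 1)).of_isClosed_subset ?_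
    fun y hy => ⟨fun a l => (hy.bounds a l).1, fun a l => (hy.bounds a l).2⟩
  have heq : {y | M.LPFeasible y} =
      {y : AgeVec n D → Alloc n L → ℝ | ∀ a l, 0 ≤ y a l ∧ y a l ≤ 1} ∩
      {y | ∀ a l, l ∉ collisionFree n L → y a l = 0} ∩
      {y | ∑ a, ∑ l ∈ collisionFree n L, y a l = 1} ∩
      {y | ∀ a', ∑ l, y a' l - ∑ a, ∑ l, y a l * step M.μ a l a' = 0} ∩
      {y | ∀ i, ∑ a, ∑ l ∈ collisionFree n L, y a l * ((l i : ℕ) : ℝ) ≤ M.b i} ∩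
      {y | ∀ k, ∑ a, ∑ l ∈ collisionFree n L, y a l * M.ω k a ≤ M.c k} := by
    ext y
    simp only [Set.mem_inter_iff, Set.mem_ofPred_eq, ← mulVec_balance]
    exact ⟨fun h => ⟨⟨⟨⟨⟨h.bounds, h.collision⟩, h.total⟩, congrFun h.balanced⟩, h.energy⟩,
      h.ageCost⟩, fun ⟨⟨⟨⟨⟨h1, h2⟩, h3⟩, h4⟩, h5⟩, h6⟩ => ⟨⟨h1, h2, h3, funext h4⟩, h5, h6⟩⟩
  rw [heq]
  simp only [Set.ofPred_forall, Set.ofPred_and]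
  refine ((((IsClosed.inter ?_ ?_).inter ?_).inter ?_).inter ?_).inter ?_
  · exact isClosed_iInter fun a => isClosed_iInter fun l =>
      (isClosed_le (by fun_prop) (by fun_prop)).inter (isClosed_le (by fun_prop) (by fun_prop))
  · exact isClosed_iInter fun a => isClosed_iInter fun l => isClosed_iInter fun _ =>
      isClosed_eq (by fun_prop) (by fun_prop)
  · exact isClosed_eq (by fun_prop) (by fun_prop)
  · exact isClosed_iInter fun a => isClosed_eq (by fun_prop) (by fun_prop)
  · exact isClosed_iInter fun i => isClosed_le (by fun_prop) (by fun_prop)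
  · exact isClosed_iInter fun k => isClosed_le (by fun_prop) (by fun_prop)

theorem exists_isLPOptimal (h : ∃ y, M.LPFeasible y) : ∃ y, M.IsLPOptimal y := by
  obtain ⟨y, hy, hmin⟩ := M.isCompact_lpFeasible.exists_isMinOn h
    (f := M.lpCost) (by unfold lpCost; fun_prop)
  exact ⟨y, hy, fun z hz => hmin hz⟩

end Problem

/-! ### The normalized rule of an LP point -/

section RuleOf

variable {M : Problem n L D K} {y : AgeVec n D → Alloc n L → ℝ}

theorem isStationaryRule_ruleOf (hy : M.IsOccupation y) : IsStationaryRule (ruleOf y) := by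
  -- The zero allocation never collides, so the uniform fallback is a probability.
  have hne : (collisionFree n L).Nonempty := ⟨fun _ => 0, by simp [collisionFree]⟩
  refine ⟨fun a => ⟨fun l => ?_, ?_⟩, fun a l hl => ?_⟩
  · unfold ruleOf
    split_ifs
    · exact div_nonneg (hy.bounds a l).1 (Finset.sum_nonneg fun l _ => (hy.bounds a l).1)
    · positivity
    · rfl
  · unfold ruleOf
    by_cases h : ∑ l', y a l' = 0
    · have hc : ((collisionFree n L).card : ℝ) ≠ 0 := by
        exact_mod_cast hne.card_pos.ne'
      simp [h, hc]
    · simp only [ne_eq, h, not_false_eq_true, if_true, ← Finset.sum_div]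
      exact div_self h
  · unfold ruleOf
    split_ifs
    · rw [hy.collision a l hl, zero_div]
    · rfl

/-- Where the age marginal vanishes, nonnegativity makes every `y a l` vanish, so the fallback is
immaterial. -/
theorem eq_mul_ruleOf (hy : M.IsOccupation y) (a : AgeVec n D) (l : Alloc n L) :
    y a l = (∑ l', y a l') * ruleOf y a l := by
  unfold ruleOf
  by_cases h : ∑ l', y a l' = 0
  · rw [h, zero_mul]
    exact (Finset.sum_eq_zero_iff_of_nonneg fun l _ => (hy.bounds a l).1).1 h l (Finset.mem_univ l)
  · rw [if_pos h, mul_div_cancel₀ _ h]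

end RuleOf

end AgeLP

end

/-! ### Equivalence of the two problems -/

theorem theorem2 {n L D K : ℕ} (hD : 1 ≤ D) (M : Problem n L D K)
    (hμ : ∀ i, 0 ≤ M.μ i ∧ M.μ i < 1)
    (ν : AgeVec n D → ℝ) (hν : ν ∈ stdSimplex ℝ (AgeVec n D)) :
    -- every randomized stationary policy is a point of the linear program
    (∀ (f : AgeVec n D → Alloc n L → ℝ) (hf : IsStationaryRule f),
      ∃ y : AgeVec n D → Alloc n L → ℝ,
        M.IsOccupation y ∧
        (∀ a l, y a l = (∑ l', y a l') * f a l) ∧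
        (∀ g : AgeVec n D → Alloc n L → ℝ,
          Tendsto (timeAvg M.μ ν (Policy.ofRule f hf) g) atTop (𝓝 (∑ a, ∑ l, y a l * g a l))) ∧
        (M.Feasible ν (Policy.ofRule f hf) ↔ M.LPFeasible y) ∧
        M.cost ν (Policy.ofRule f hf) = M.lpCost y) ∧
    -- every point of the linear program is the long-run average of the normalized policy
    (∀ y : AgeVec n D → Alloc n L → ℝ, M.LPFeasible y →
      ∃ hf : IsStationaryRule (ruleOf y),
        (∀ g : AgeVec n D → Alloc n L → ℝ,
          Tendsto (timeAvg M.μ ν (Policy.ofRule (ruleOf y) hf) g) atTop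
            (𝓝 (∑ a, ∑ l, y a l * g a l))) ∧
        M.Feasible ν (Policy.ofRule (ruleOf y) hf) ∧
        M.cost ν (Policy.ofRule (ruleOf y) hf) = M.lpCost y) ∧
    -- the two problems are feasible together and have the same minimum, over all policies
    ((∃ φ : Policy n L D, M.Feasible ν φ) ↔ ∃ y, M.LPFeasible y) ∧
    (∀ v : ℝ, IsLeast {r | ∃ φ : Policy n L D, M.Feasible ν φ ∧ M.cost ν φ = r} v ↔
      IsLeast {r | ∃ y, M.LPFeasible y ∧ M.lpCost y = r} v) ∧
    -- a feasible linear program has an optimal solution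
    ((∃ y, M.LPFeasible y) → ∃ y, M.IsLPOptimal y) ∧
    -- an optimal solution of the linear program yields an optimal randomized stationary policy
    (∀ y : AgeVec n D → Alloc n L → ℝ, M.IsLPOptimal y →
      ∃ hf : IsStationaryRule (ruleOf y),
        M.IsOptimal ν (Policy.ofRule (ruleOf y) hf) ∧
        M.cost ν (Policy.ofRule (ruleOf y) hf) = M.lpCost y) := by
  have part1 : ∀ (f : AgeVec n D → Alloc n L → ℝ) (hf : IsStationaryRule f),
      ∃ y : AgeVec n D → Alloc n L → ℝ, M.IsOccupation y ∧
        (∀ a l, y a l = (∑ l', y a l') * f a l) ∧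
        Tendsto (avgOcc M.μ ν (Policy.ofRule f hf)) atTop (𝓝 y) := by
    intro f hf
    obtain ⟨U, y, hU, hy⟩ := exists_ultrafilter_tendsto_avgOcc hD hμ hν (Policy.ofRule f hf)
    have hocc := isOccupation_of_tendsto hD hμ hν hU hy
    have hyf := eq_mul_of_tendsto hy
    exact ⟨y, hocc, hyf, tendsto_avgOcc_ofRule hD hμ hν hf hocc hyf⟩
  have part2 : ∀ y : AgeVec n D → Alloc n L → ℝ, M.LPFeasible y →
      ∃ hf : IsStationaryRule (ruleOf y),
        (∀ g : AgeVec n D → Alloc n L → ℝ,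
          Tendsto (timeAvg M.μ ν (Policy.ofRule (ruleOf y) hf) g) atTop
            (𝓝 (∑ a, ∑ l, y a l * g a l))) ∧
        M.Feasible ν (Policy.ofRule (ruleOf y) hf) ∧
        M.cost ν (Policy.ofRule (ruleOf y) hf) = M.lpCost y := by
    intro y hy
    have hocc := hy.toIsOccupation
    have hf := isStationaryRule_ruleOf hocc
    have ht := tendsto_avgOcc_ofRule hD hμ hν hf hocc (eq_mul_ruleOf hocc)
    exact ⟨hf, tendsto_timeAvg ht, (Problem.feasible_iff_of_tendsto ht hocc).2 hy,
      Problem.cost_eq_of_tendsto ht hocc⟩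
  have lower : ∀ φ : Policy n L D, M.Feasible ν φ → ∃ y, M.LPFeasible y ∧
      M.lpCost y ≤ M.cost ν φ := fun φ h => h.exists_lpFeasible hD hμ hν
  refine ⟨fun f hf => ?_, part2, ⟨?_, ?_⟩, fun v => ⟨?_, ?_⟩, Problem.exists_isLPOptimal, ?_⟩
  · obtain ⟨y, hocc, hyf, ht⟩ := part1 f hf
    exact ⟨y, hocc, hyf, tendsto_timeAvg ht, Problem.feasible_iff_of_tendsto ht hocc,
      Problem.cost_eq_of_tendsto ht hocc⟩
  · rintro ⟨φ, hφ⟩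
    obtain ⟨y, hy, -⟩ := lower φ hφ
    exact ⟨y, hy⟩
  · rintro ⟨y, hy⟩
    obtain ⟨hf, -, hfeas, -⟩ := part2 y hy
    exact ⟨_, hfeas⟩
  · rintro ⟨⟨φ, hφ, rfl⟩, hmin⟩
    -- Normalized rules put the policy minimum below every LP value; `lower` supplies an LP point
    -- that attains it.
    have hlb : ∀ y, M.LPFeasible y → M.cost ν φ ≤ M.lpCost y := by
      intro y hy
      obtain ⟨hf, -, hfeas, hcost⟩ := part2 y hy
      exact hmin ⟨_, hfeas, hcost⟩
    obtain ⟨y, hy, hle⟩ := lower φ hφ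
    refine ⟨⟨y, hy, le_antisymm hle (hlb y hy)⟩, ?_⟩
    rintro _ ⟨z, hz, rfl⟩
    exact hlb z hz
  · rintro ⟨⟨y, hy, rfl⟩, hmin⟩
    obtain ⟨hf, -, hfeas, hcost⟩ := part2 y hy
    refine ⟨⟨_, hfeas, hcost⟩, ?_⟩
    rintro _ ⟨φ, hφ, rfl⟩
    obtain ⟨z, hz, hle⟩ := lower φ hφ
    exact (hmin ⟨z, hz, rfl⟩).trans hle
  · rintro y ⟨hy, hmin⟩
    obtain ⟨hf, -, hfeas, hcost⟩ := part2 y hy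
    refine ⟨hf, ⟨hfeas, fun ψ hψ => ?_⟩, hcost⟩
    obtain ⟨z, hz, hle⟩ := lower ψ hψ
    exact hcost.trans_le ((hmin z hz).trans hle)
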